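/- For $0<\varepsilon<1$ and an integer $C\ge 1$ define (with the natural logarithm) $$ f(\varepsilon,C)=\begin{cases} \varepsilon C & \text{if } C\le \log(1/\varepsilon),\\ \varepsilon\sqrt{C}\cdot\sqrt{\log\bigl(1/(\varepsilon\sqrt{C})\bigr)} & \text{if } \log(1/\varepsilon)< C<\frac{1}{2\varepsilon^2},\\ 1 & \text{if } C\ge \frac{1}{2\varepsilon^2}. \end{cases} $$ Let $n,m\in\mathbb N$ and $0<\varepsilon<1$ be such that $C=(1+\varepsilon)n/m$ is a positive integer. Distribute $n$ balls one at a time into $m$ initially empty bins, each of capacity $C$ (a bin is full if it contains exactly $C$ balls), where each ball is placed in a uniformly random non-full bin, given the placement of the preceding balls. Let $X$ be the fraction of the $m$ bins that are non-full after all $n$ balls have been placed. If $1/\varepsilon=m^{o(1)}$, then $\mathbb E[X]=\Theta(f(\varepsilon,C))$. Precisely: there are absolute constants $c_1,c_2>0$ such that for every function $g:\mathbb N\to\mathbb R$ with $g(m)\to 0$ as $m\to\infty$ there is an $m_0$ such that for all $m\ge m_0$, all $n\in\mathbb N$ and all $0<\varepsilon<1$ for which $C=(1+\varepsilon)n/m$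 is a positive integer and $1/\varepsilon\le m^{g(m)}$, $$ c_1\, f(\varepsilon,C)\le \mathbb E[X]\le c_2\, f(\varepsilon,C). $$ -/

import Mathlib

open Filter Topology MeasureTheory

noncomputable section

namespace CapacitatedBins

/-- The non-full bins of a configuration: `x j` is the number of balls in bin `j`, and a bin is
full once it holds `C` balls. -/
def nonFull {m : ℕ} (C : ℕ) (x : Fin m → ℕ) : Finset (Fin m) :=
  Finset.univ.filter fun j => x j < C

/-- The configuration obtained from `x` by adding one ball to bin `j`. -/
def place {m : ℕ} (x : Fin m → ℕ) (j : Fin m) : Fin m → ℕ :=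
  Function.update x j (x j + 1)

/-- One random step: the next ball goes to a uniformly random non-full bin. If every bin is full,
which cannot occur while fewer than `C * m` balls have been placed, nothing changes. -/
def step {m : ℕ} (C : ℕ) (x : Fin m → ℕ) : PMF (Fin m → ℕ) :=
  if h : (nonFull C x).Nonempty then (PMF.uniformOfFinset (nonFull C x) h).map (place x)
  else PMF.pure x

/-- The law of the configuration after sequentially placing `n` balls into `m` initially empty
bins of capacity `C`. -/
def loadLaw (m C : ℕ) : ℕ → PMF (Fin m → ℕ)
  | 0 => PMF.pure fun _ => 0
  | n + 1 => (loadLaw m C n).bind (step C)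

/-- The expected fraction of non-full bins after `n` balls have been placed. -/
def expectedNonFullFraction (m C n : ℕ) : ℝ :=
  ∫ x, ((nonFull C x).card : ℝ) / m ∂(loadLaw m C n).toMeasure

/-- The three-regime function `f` of `ε` and `C` (natural logarithm). -/
def f (ε : ℝ) (C : ℕ) : ℝ :=
  if (C : ℝ) ≤ Real.log (1 / ε) then ε * C
  else if (C : ℝ) < 1 / (2 * ε ^ 2) then
    ε * Real.sqrt C * Real.sqrt (Real.log (1 / (ε * Real.sqrt C)))
  else 1

end CapacitatedBins

end

noncomputable section

namespace CapacitatedBins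

/-! Poissonize: let balls arrive at each bin independently at rate 1, a ball being lost when its bin
is full. The successful arrivals form exactly the given process, while at time `l` the loads are
independent copies of `min C N` with `N` Poisson of mean `l`. Write `C = d + 1`. The expected
fraction of non-full bins at time `l` is `tail d l`, and the expected number of free places per bin
is `gap d l`.

The coupling is replaced by a generator argument. The conditional expectation of `X`, continued past
`n` balls by `frac` or by `1`, is a super- or submartingale (`prodMean_value_le`,
`le_prodMean_upperValue`). Chebyshev's inequality for the number of free places then places `E[X]`,
up to a small error, between tails at times where the gap is at most half, or equal to twice, the
final average `η` of free places per bin.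

It remains to find `tail d l` when `gap d l` is of order `η`, hence of order `εC`. The hazard rate
`r = tail / gap` is minus the derivative of `log gap`. Log-concavity of iterated partial sums gives
`1 + (l - C) r ≤ l r² ≤ 2 + (l - C) r` (`gap_sq_le`, `tail_sq_le`), so for `l ≥ C` the rate `r` has
the order of the larger of `(l - C) / l` and `1 / √l`. Stirling gives `gap ≍ √C` at `l = C`.
Integrating `r` from there locates `l`, and `tail = r * gap` yields the three regimes of `f`. -/

/-- The Poisson probability of the value `k` at mean `l`. -/
def poi (l : ℝ) (k : ℕ) : ℝ := Real.exp (-l) * l ^ k / (k.factorial : ℝ)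

/-! ### Log-concave sequences and their partial sums. -/

/-- The partial sums of a sequence, last term included. -/
def psum (u : ℕ → ℝ) (d : ℕ) : ℝ := ∑ k ∈ Finset.range (d + 1), u k

/-- A positive sequence with non-increasing consecutive ratios. -/
def LogConc (u : ℕ → ℝ) : Prop :=
  (∀ k, 0 < u k) ∧ ∀ k, u k * u (k + 2) ≤ u (k + 1) * u (k + 1)

theorem psum_zero (u : ℕ → ℝ) : psum u 0 = u 0 := by simp [psum]

theorem psum_succ (u : ℕ → ℝ) (d : ℕ) : psum u (d + 1) = psum u d + u (d + 1) :=
  Finset.sum_range_succ _ _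

theorem psum_pos {u : ℕ → ℝ} (hu : ∀ k, 0 < u k) (d : ℕ) : 0 < psum u d :=
  Finset.sum_pos (fun k _ => hu k) ⟨0, by simp⟩

/-- Non-increasing ratios give `u k * u (d + 2) ≤ u (k + 1) * u (d + 1)` for `k ≤ d`; summing over
`k` shifts the partial sum and loses the term `u 0`. -/
theorem LogConc.psum_mul_le {u : ℕ → ℝ} (hu : LogConc u) (d : ℕ) :
    psum u d * u (d + 2) ≤ psum u (d + 1) * u (d + 1) - u 0 * u (d + 1) := by
  induction d with
  | zero =>
    have := hu.2 0
    simp only [psum_succ, psum_zero] at *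
    nlinarith
  | succ d ih =>
    have h0 := hu.1 (d + 2)
    have h3 := hu.2 (d + 1)
    have h4 := psum_pos hu.1 d
    have h5 := hu.1 (d + 1)
    have key : psum u d * u (d + 3) ≤ (psum u (d + 1) - u 0) * u (d + 2) := by
      have e1 : psum u d * u (d + 3) * u (d + 1) ≤ psum u d * (u (d + 2) * u (d + 2)) := by
        nlinarith [h3, h4]
      have e2 : psum u d * u (d + 2) * u (d + 2) ≤
          (psum u (d + 1) - u 0) * u (d + 1) * u (d + 2) := by
        have : psum u d * u (d + 2) ≤ (psum u (d + 1) - u 0) * u (d + 1) := by linarith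
        exact mul_le_mul_of_nonneg_right this h0.le
      refine le_of_mul_le_mul_right ?_ h5
      nlinarith
    have e3 := psum_succ u d
    have e4 := psum_succ u (d + 1)
    have e5 : psum u (d + 1) * u (d + 3) ≤
      (psum u (d + 1) - u 0) * u (d + 2) + u (d + 2) * u (d + 2) := by
      rw [show psum u (d + 1) * u (d + 3) = psum u d * u (d + 3) + u (d + 1) * u (d + 3) by
        rw [e3]; ring]
      exact add_le_add key h3
    calc psum u (d + 1) * u (d + 3) ≤ _ := e5
      _ = psum u (d + 1 + 1) * u (d + 2) - u 0 * u (d + 2) := by rw [e4]; ring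

theorem LogConc.partialSums {u : ℕ → ℝ} (hu : LogConc u) : LogConc (psum u) := by
  refine ⟨psum_pos hu.1, fun k => ?_⟩
  have h := hu.psum_mul_le k
  have h1 := mul_pos (hu.1 0) (hu.1 (k + 1))
  rw [show k + 2 = k + 1 + 1 from rfl, psum_succ u (k + 1)]
  have h2 := psum_succ u k
  have h3 : psum u (k + 1) * psum u (k + 1) =
    psum u (k + 1) * psum u k
      + psum u (k + 1) * u (k + 1) := by
    rw [← mul_add, ← h2]
  rw [show k + 1 + 1 = k + 2 from rfl]
  nlinarith

/-- For a log-concave sequence `u`, the double partial sum `V` satisfies `u V ≤ U ^ 2` with `U`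
the partial sum. -/
theorem LogConc.mul_psum_psum_le {u : ℕ → ℝ} (hu : LogConc u) (d : ℕ) :
    u d * psum (psum u) d ≤
      psum u d * psum u d := by
  cases d with
  | zero => simp [psum_zero]
  | succ d =>
    have h := hu.partialSums
    set U := psum u with hU
    -- Substituting `u (d + 1) = U (d + 1) - U d` turns the goal into this inequality: the ratio `U
    -- / psum U` does not increase.
    have key : psum U d * U (d + 1) ≤ psum U (d + 1) * U d := by
      cases d with
      | zero =>
        simp only [psum_succ, psum_zero]
        nlinarith [h.1 0, h.1 1, mul_pos (h.1 0) (h.1 0)]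
      | succ d =>
        have h1 := h.psum_mul_le d
        have h2 := mul_pos (h.1 0) (h.1 (d + 1))
        have e1 := psum_succ U d
        have e2 := psum_succ U (d + 1)
        have h3 := h.2 d
        rw [e2, e1]
        rw [e1] at h1
        rw [show d + 1 + 1 = d + 2 from rfl]
        nlinarith
    have e1 : U (d + 1) = U d + u (d + 1) := psum_succ u d
    have e2 := psum_succ U d
    have e3 : u (d + 1) = U (d + 1) - U d := by linarith
    rw [e3]
    have e4 : psum U d = psum U (d + 1) - U (d + 1) := by linarith
    rw [e4] at key
    nlinarith

/-! ### Poisson weights, tail and gap. -/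

theorem poi_pos {l : ℝ} (hl : 0 < l) (k : ℕ) : 0 < poi l k := by
  unfold poi; positivity

theorem poi_nonneg {l : ℝ} (hl : 0 ≤ l) (k : ℕ) : 0 ≤ poi l k := by
  unfold poi; positivity

theorem succ_mul_poi (l : ℝ) (k : ℕ) : ((k : ℝ) + 1) * poi l (k + 1) = l * poi l k := by
  unfold poi
  rw [Nat.factorial_succ]
  push_cast
  field_simp
  ring

theorem logConc_poi {l : ℝ} (hl : 0 < l) : LogConc (poi l) := by
  refine ⟨poi_pos hl, fun k => ?_⟩
  have h1 := succ_mul_poi l k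
  have h2 := succ_mul_poi l (k + 1)
  have p0 := poi_pos hl k
  have p1 := poi_pos hl (k + 1)
  have p2 := poi_pos hl (k + 2)
  push_cast at h2
  have e : ((k : ℝ) + 2) * (l * (poi l k * poi l (k + 2))) =
      ((k : ℝ) + 1) * (l * (poi l (k + 1) * poi l (k + 1))) := by
    have : ((k : ℝ) + 2) * poi l (k + 2) = l * poi l (k + 1) := by
      rw [← h2]; norm_num; left; ring
    calc _ = (l * poi l k) * (((k : ℝ) + 2) * poi l (k + 2)) := by ring
      _ = _ := by rw [this, ← h1]; ring
  have hk : (0 : ℝ) ≤ k := k.cast_nonneg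
  have q := mul_pos hl (mul_pos p1 p1)
  have : ((k : ℝ) + 2) * (l * (poi l k * poi l (k + 2))) ≤
      ((k : ℝ) + 2) * (l * (poi l (k + 1) * poi l (k + 1))) := by rw [e]; nlinarith
  exact le_of_mul_le_mul_left (le_of_mul_le_mul_left this (by positivity)) hl

/-- `P(N ≤ d)` for a Poisson variable `N` of mean `l`. -/
def tail (d : ℕ) (l : ℝ) : ℝ := psum (poi l) d

/-- `E (d + 1 - N)⁺` for a Poisson variable `N` of mean `l`. -/
def gap (d : ℕ) (l : ℝ) : ℝ := psum (psum (poi l)) d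

theorem tail_pos {l : ℝ} (hl : 0 < l) (d : ℕ) : 0 < tail d l := psum_pos (poi_pos hl) d

theorem gap_pos {l : ℝ} (hl : 0 < l) (d : ℕ) : 0 < gap d l :=
  psum_pos (psum_pos (poi_pos hl)) d

theorem gap_eq (d : ℕ) (l : ℝ) : gap d l = ((d : ℝ) + 1 - l) * tail d l + l * poi l d := by
  unfold gap tail
  induction d with
  | zero => simp [psum_zero]; ring
  | succ d ih =>
    rw [psum_succ, ih, psum_succ]
    have := succ_mul_poi l d
    push_cast
    linear_combination -this

/-- The left side is the expectation of `(d + 1 - N)(d + 2 - N)` over `N ≤ d`; this is the analogue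
of `gap_eq` one summation higher. -/
theorem two_mul_psum_gap (d : ℕ) (l : ℝ) :
    2 * psum (psum (psum (poi l))) d = ((d : ℝ) + 2 - l) * gap d l + l * tail d l := by
  have key := gap_eq
  unfold gap tail at *
  induction d with
  | zero => simp [psum_zero]; ring
  | succ d ih =>
    have k1 := key (d + 1) l
    rw [psum_succ, mul_add, ih]
    push_cast at *
    rw [psum_succ (psum (poi l))] at *
    rw [psum_succ (poi l)] at *
    linear_combination k1

theorem tail_le_gap {l : ℝ} (hl : 0 < l) (d : ℕ) : tail d l ≤ gap d l := by
  unfold tail gap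
  rw [psum.eq_def (psum (poi l)), Finset.sum_range_succ]
  have : 0 ≤ ∑ k ∈ Finset.range d, psum (poi l) k :=
    Finset.sum_nonneg fun k _ => (psum_pos (poi_pos hl) k).le
  linarith

/-! ### Quadratic inequalities for the hazard rate. -/

theorem gap_sq_le {l : ℝ} (hl : 0 < l) (d : ℕ) :
    gap d l ^ 2 + (l - ((d : ℝ) + 1)) * tail d l * gap d l ≤ l * tail d l ^ 2 := by
  have h := (logConc_poi hl).mul_psum_psum_le d
  have e := gap_eq d l
  change poi l d * gap d l ≤ tail d l * tail d l at h
  have : l * (poi l d * gap d l) ≤ l * (tail d l * tail d l) := mul_le_mul_of_nonneg_left h hl.le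
  have e2 : l * poi l d = gap d l - ((d : ℝ) + 1 - l) * tail d l := by linarith
  have e3 : l * (poi l d * gap d l) = (gap d l - ((d : ℝ) + 1 - l) * tail d l) * gap d l := by
    rw [← e2]; ring
  rw [e3] at this
  nlinarith

/-- The log-concavity argument of `gap_sq_le`, applied to the partial sums of the weights instead of
the weights. -/
theorem tail_sq_le {l : ℝ} (hl : 0 < l) (d : ℕ) :
    l * tail d l ^ 2 ≤ 2 * gap d l ^ 2 + (l - ((d : ℝ) + 1)) * tail d l * gap d l := by
  have h := (logConc_poi hl).partialSums.mul_psum_psum_le d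
  have e := two_mul_psum_gap d l
  change tail d l * psum (psum (psum (poi l))) d ≤ gap d l * gap d l at h
  have h1 := mul_pos (tail_pos hl d) (gap_pos hl d)
  have e3 : 2 * (tail d l * psum (psum (psum (poi l))) d) =
    tail d l * (((d : ℝ) + 2 - l) * gap d l + l * tail d l) := by rw [← e]; ring
  nlinarith

theorem hazard_ge {l : ℝ} (hl : 0 < l) (d : ℕ) :
    (l - ((d : ℝ) + 1)) * gap d l ≤ l * tail d l := by
  have h := gap_sq_le hl d
  have hb := tail_pos hl d
  have ha := gap_pos hl d
  refine le_of_mul_le_mul_right ?_ hb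
  nlinarith [sq_nonneg (gap d l)]

theorem hazard_ge_sqrt {l : ℝ} (d : ℕ) (hd : (d : ℝ) + 1 ≤ l) :
    gap d l ≤ √l * tail d l := by
  have hl : 0 < l := lt_of_lt_of_le (by positivity) hd
  have h := gap_sq_le hl d
  have hb := tail_pos hl d
  have ha := gap_pos hl d
  have : 0 ≤ (l - ((d : ℝ) + 1)) * tail d l * gap d l :=
    mul_nonneg (mul_nonneg (by linarith) hb.le) ha.le
  refine abs_le_of_sq_le_sq' ?_ (by positivity) |>.2
  rw [mul_pow, Real.sq_sqrt hl.le]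
  linarith

/-- The hypotheses bound each summand of `2 + (l - (d + 1)) R` by half of `l R²`, so `R` lies beyond
the larger root of the quadratic in `tail_sq_le`. -/
theorem hazard_le {l R : ℝ} (d : ℕ) (hd : (d : ℝ) + 1 ≤ l) (hR : 0 < R)
    (h1 : 2 * (l - ((d : ℝ) + 1)) ≤ l * R) (h2 : 4 ≤ l * R ^ 2) :
    tail d l ≤ R * gap d l := by
  have hl : 0 < l := lt_of_lt_of_le (by positivity) hd
  have h := tail_sq_le hl d
  have hb := tail_pos hl d
  have ha := gap_pos hl d
  by_contra! hc
  have c1 : 2 * (l - ((d : ℝ) + 1)) * (tail d l * gap d l) ≤ l * R * (tail d l * gap d l) :=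
    mul_le_mul_of_nonneg_right h1 (by positivity)
  have c2 : l * tail d l * (R * gap d l) < l * tail d l * tail d l :=
    mul_lt_mul_of_pos_left hc (by positivity)
  have c3 : (R * gap d l) ^ 2 < tail d l ^ 2 := pow_lt_pow_left₀ hc (by positivity) (by norm_num)
  have c4 : 4 * gap d l ^ 2 ≤ l * R ^ 2 * gap d l ^ 2 :=
    mul_le_mul_of_nonneg_right h2 (by positivity)
  have c5 : l * (R * gap d l) ^ 2 < l * tail d l ^ 2 := mul_lt_mul_of_pos_left c3 hl
  nlinarith

/-! ### Dependence on the mean, and integration of the hazard rate. -/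

theorem hasDerivAt_poi_zero (l : ℝ) : HasDerivAt (fun l => poi l 0) (-poi l 0) l := by
  unfold poi
  simpa using (hasDerivAt_neg l).exp

theorem hasDerivAt_poi_succ (k : ℕ) (l : ℝ) :
    HasDerivAt (fun l => poi l (k + 1)) (poi l k - poi l (k + 1)) l := by
  unfold poi
  have h1 : HasDerivAt (fun l : ℝ => Real.exp (-l)) (-Real.exp (-l)) l := by
    simpa using (hasDerivAt_neg l).exp
  have h2 := (h1.mul (hasDerivAt_pow (k + 1) l)).div_const ((k + 1).factorial : ℝ)
  refine h2.congr_deriv ?_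
  rw [Nat.factorial_succ]
  push_cast
  field_simp
  ring

theorem hasDerivAt_tail (d : ℕ) (l : ℝ) : HasDerivAt (tail d) (-poi l d) l := by
  induction d with
  | zero =>
    have : tail 0 = fun l => poi l 0 := funext fun l => psum_zero _
    rw [this]; exact hasDerivAt_poi_zero l
  | succ d ih =>
    have : tail (d + 1) = fun l => tail d l + poi l (d + 1) := funext fun l => psum_succ _ _
    rw [this]
    exact (ih.add (hasDerivAt_poi_succ d l)).congr_deriv (by ring)

theorem hasDerivAt_gap (d : ℕ) (l : ℝ) : HasDerivAt (gap d) (-tail d l) l := by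
  induction d with
  | zero =>
    have : gap 0 = tail 0 := funext fun l => psum_zero _
    rw [this]
    exact (hasDerivAt_tail 0 l).congr_deriv (by simp [tail, psum_zero])
  | succ d ih =>
    have : gap (d + 1) = fun l => gap d l + tail (d + 1) l := funext fun l => psum_succ _ _
    rw [this]
    refine (ih.add (hasDerivAt_tail (d + 1) l)).congr_deriv ?_
    unfold tail; rw [psum_succ]; ring

theorem continuous_gap (d : ℕ) : Continuous (gap d) :=
  continuous_iff_continuousAt.2 fun l => (hasDerivAt_gap d l).continuousAt

theorem gap_antitoneOn (d : ℕ) : AntitoneOn (gap d) (Set.Ioi 0) := by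
  refine antitoneOn_of_deriv_nonpos (convex_Ioi 0) (continuous_gap d).continuousOn
    (fun x _ => (hasDerivAt_gap d x).differentiableAt.differentiableWithinAt) fun x hx => ?_
  rw [interior_Ioi] at hx
  rw [(hasDerivAt_gap d x).deriv]
  linarith [tail_pos hx d]

theorem hasDerivAt_gap_mul_exp (d : ℕ) (R l : ℝ) :
    HasDerivAt (fun v => gap d v * Real.exp (R * v))
      ((R * gap d l - tail d l) * Real.exp (R * l)) l := by
  have h1 : HasDerivAt (fun v : ℝ => Real.exp (R * v)) (Real.exp (R * l) * R) l := by
    simpa using ((hasDerivAt_id l).const_mul R).exp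
  exact ((hasDerivAt_gap d l).mul h1).congr_deriv (by ring)

theorem le_gap_of_hazard_le {d : ℕ} {R x y : ℝ} (hxy : x ≤ y)
    (h : ∀ v ∈ Set.Icc x y, tail d v ≤ R * gap d v) :
    gap d x * Real.exp (-(R * (y - x))) ≤ gap d y := by
  have hm : MonotoneOn (fun v => gap d v * Real.exp (R * v)) (Set.Icc x y) := by
    refine monotoneOn_of_deriv_nonneg (convex_Icc x y)
      (fun v _ => (hasDerivAt_gap_mul_exp d R v).continuousAt.continuousWithinAt)
      (fun v _ => (hasDerivAt_gap_mul_exp d R v).differentiableAt.differentiableWithinAt)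
      fun v hv => ?_
    rw [(hasDerivAt_gap_mul_exp d R v).deriv]
    have := h v (interior_subset hv)
    exact mul_nonneg (by linarith) (Real.exp_pos _).le
  have := hm (Set.left_mem_Icc.2 hxy) (Set.right_mem_Icc.2 hxy) hxy
  simp only at this
  rw [show -(R * (y - x)) = R * x - R * y by ring, Real.exp_sub, ← mul_div_assoc,
    div_le_iff₀ (Real.exp_pos _)]
  exact this

theorem gap_le_of_le_hazard {d : ℕ} {R x y : ℝ} (hxy : x ≤ y)
    (h : ∀ v ∈ Set.Icc x y, R * gap d v ≤ tail d v) :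
    gap d y ≤ gap d x * Real.exp (-(R * (y - x))) := by
  have hm : AntitoneOn (fun v => gap d v * Real.exp (R * v)) (Set.Icc x y) := by
    refine antitoneOn_of_deriv_nonpos (convex_Icc x y)
      (fun v _ => (hasDerivAt_gap_mul_exp d R v).continuousAt.continuousWithinAt)
      (fun v _ => (hasDerivAt_gap_mul_exp d R v).differentiableAt.differentiableWithinAt)
      fun v hv => ?_
    rw [(hasDerivAt_gap_mul_exp d R v).deriv]
    have := h v (interior_subset hv)
    exact mul_nonpos_of_nonpos_of_nonneg (by linarith) (Real.exp_pos _).le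
  have := hm (Set.left_mem_Icc.2 hxy) (Set.right_mem_Icc.2 hxy) hxy
  simp only at this
  rw [show -(R * (y - x)) = R * x - R * y by ring, Real.exp_sub, ← mul_div_assoc,
    le_div_iff₀ (Real.exp_pos _)]
  exact this

theorem tendsto_gap (d : ℕ) : Tendsto (gap d) atTop (𝓝 0) := by
  have hp : ∀ k, Tendsto (fun l => poi l k) atTop (𝓝 0) := fun k => by
    have h := (Real.tendsto_pow_mul_exp_neg_atTop_nhds_zero k).div_const (k.factorial : ℝ)
    rw [zero_div] at h
    refine h.congr fun l => ?_
    unfold poi; ring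
  have hs : ∀ F : ℝ → ℕ → ℝ, (∀ k, Tendsto (fun l => F l k) atTop (𝓝 0)) →
      ∀ k, Tendsto (fun l => psum (F l) k) atTop (𝓝 0) := fun F hF k => by
    have := tendsto_finsetSum (Finset.range (k + 1)) fun i _ => hF i
    simpa [psum] using this
  exact hs _ (hs _ hp) d

theorem exists_gap_eq {d : ℕ} {t : ℝ} (ht : 0 < t) (h : t ≤ gap d ((d : ℝ) + 1)) :
    ∃ l, (d : ℝ) + 1 ≤ l ∧ gap d l = t := by
  obtain ⟨y, hy1, hy2⟩ := (((tendsto_gap d).eventually (gt_mem_nhds ht)).and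
    (eventually_ge_atTop ((d : ℝ) + 1))).exists
  obtain ⟨l, hl, e⟩ := intermediate_value_Icc' hy2 (continuous_gap d).continuousOn ⟨hy1.le, h⟩
  exact ⟨l, hl.1, e⟩

/-- Since the gap is antitone, a level below `gap d x` is attained only beyond `x`. -/
theorem le_of_gap_le {d : ℕ} {x l : ℝ} (hl : 0 < l) (hx : 0 < x)
    (h : gap d l < gap d x) : x ≤ l := by
  by_contra! hc
  exact absurd (gap_antitoneOn d (Set.mem_Ioi.2 hl) (Set.mem_Ioi.2 hx) hc.le) (not_le.2 h)

/-! ### The gap at mean `d + 1`, by Stirling. -/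

theorem gap_mean (d : ℕ) :
    gap d ((d : ℝ) + 1) = ((d : ℝ) + 1) * poi ((d : ℝ) + 1) (d + 1) := by
  rw [gap_eq, succ_mul_poi]; ring

theorem gap_mean_le (d : ℕ) : gap d ((d : ℝ) + 1) ≤ √((d : ℝ) + 1) := by
  rw [gap_mean]
  have h := Stirling.le_factorial_stirling (d + 1)
  set c : ℝ := (d : ℝ) + 1 with hc
  have hcp : 0 < c := by positivity
  push_cast at h
  rw [← hc] at h
  have hs : √c ≤ √(2 * Real.pi * c) := Real.sqrt_le_sqrt (by nlinarith [Real.pi_gt_three])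
  have h2 : √c * (c / Real.exp 1) ^ (d + 1) ≤ ((d + 1).factorial : ℝ) :=
    (mul_le_mul_of_nonneg_right hs (by positivity)).trans h
  have he : Real.exp (-c) = (Real.exp 1 ^ (d + 1))⁻¹ := by
    rw [← Real.exp_nat_mul, Real.exp_neg]; congr 2; push_cast; rw [hc]; ring
  unfold poi
  rw [he]
  rw [div_pow] at h2
  rw [← mul_div_assoc, div_le_iff₀ (by positivity)]
  have e : c * ((Real.exp 1 ^ (d + 1))⁻¹ * c ^ (d + 1)) =
      √c * (√c * (c ^ (d + 1) / Real.exp 1 ^ (d + 1))) := by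
    rw [← mul_assoc √c, Real.mul_self_sqrt hcp.le]; field_simp
  rw [e]
  exact mul_le_mul_of_nonneg_left h2 (by positivity)

theorem factorial_succ_le (d : ℕ) :
    ((d + 1).factorial : ℝ) ≤
      Real.exp 1 * (√((d : ℝ) + 1) * (((d : ℝ) + 1) / Real.exp 1) ^ (d + 1)) := by
  have h : Stirling.stirlingSeq (d + 1) ≤ Stirling.stirlingSeq 1 :=
    Stirling.stirlingSeq'_antitone (Nat.zero_le d)
  rw [Stirling.stirlingSeq_one, Stirling.stirlingSeq, div_le_iff₀ (by positivity)] at h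
  push_cast at h
  refine h.trans (le_of_eq ?_)
  rw [Real.sqrt_mul (by norm_num)]
  field_simp

theorem le_gap_mean (d : ℕ) : √((d : ℝ) + 1) ≤ Real.exp 1 * gap d ((d : ℝ) + 1) := by
  rw [gap_mean]
  have h := factorial_succ_le d
  set c : ℝ := (d : ℝ) + 1 with hc
  have hcp : 0 < c := by positivity
  have he : Real.exp (-c) = (Real.exp 1 ^ (d + 1))⁻¹ := by
    rw [← Real.exp_nat_mul, Real.exp_neg]; congr 2; push_cast; rw [hc]; ring
  unfold poi
  rw [he]
  rw [div_pow] at h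
  rw [← mul_div_assoc, ← mul_div_assoc, le_div_iff₀ (by positivity)]
  have e : Real.exp 1 * (c * ((Real.exp 1 ^ (d + 1))⁻¹ * c ^ (d + 1))) =
      √c * (Real.exp 1 * (√c * (c ^ (d + 1) / Real.exp 1 ^ (d + 1)))) := by
    have : √c * √c = c := Real.mul_self_sqrt hcp.le
    linear_combination (- Real.exp 1 * (Real.exp 1 ^ (d + 1))⁻¹ * c ^ (d + 1)) * this
  rw [e]
  exact mul_le_mul_of_nonneg_left h (by positivity)

/-! ### The chain as an iterated Markov operator. -/

theorem tsum_bind_mul {α β : Type*} (p : PMF α) (q : α → PMF β) (F : β → ENNReal) :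
    ∑' y, (p.bind q) y * F y = ∑' x, p x * ∑' y, q x y * F y := by
  simp only [PMF.bind_apply, ← ENNReal.tsum_mul_right, ← ENNReal.tsum_mul_left]
  rw [ENNReal.tsum_comm]
  simp only [mul_assoc]

theorem tsum_pure_mul {α : Type*} (a : α) (F : α → ENNReal) :
    ∑' y, (PMF.pure a) y * F y = F a := by
  rw [tsum_eq_single a fun b hb => by simp [PMF.pure_apply, hb]]
  simp

theorem integral_toMeasure_eq_toReal_tsum {α : Type*} [Countable α] [MeasurableSpace α]
    [MeasurableSingletonClass α] (p : PMF α) {φ : α → ℝ} (hφ : ∀ x, 0 ≤ φ x) :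
    ∫ x, φ x ∂p.toMeasure = (∑' x, p x * ENNReal.ofReal (φ x)).toReal := by
  rw [integral_eq_lintegral_of_nonneg_ae (Eventually.of_forall hφ)
    (measurable_of_countable φ).aestronglyMeasurable, lintegral_countable']
  simp_rw [PMF.toMeasure_apply_singleton _ _ (measurableSet_singleton _), mul_comm]

/-- The Markov operator of `step`. -/
def avg {m : ℕ} (C : ℕ) (φ : (Fin m → ℕ) → ℝ) (x : Fin m → ℕ) : ℝ :=
  if (nonFull C x).Nonempty then (∑ j ∈ nonFull C x, φ (place x j)) / (nonFull C x).card else φ x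

theorem avg_nonneg {m C : ℕ} {φ : (Fin m → ℕ) → ℝ} (hφ : ∀ x, 0 ≤ φ x) (x : Fin m → ℕ) :
    0 ≤ avg C φ x := by
  unfold avg
  split_ifs
  · exact div_nonneg (Finset.sum_nonneg fun j _ => hφ _) (Nat.cast_nonneg _)
  · exact hφ x

theorem avg_mono {m C : ℕ} {φ ψ : (Fin m → ℕ) → ℝ} (h : ∀ x, φ x ≤ ψ x) (x : Fin m → ℕ) :
    avg C φ x ≤ avg C ψ x := by
  unfold avg
  split_ifs
  · gcongr with j _
    exact h _
  · exact h x

theorem tsum_step_mul {m C : ℕ} {φ : (Fin m → ℕ) → ℝ} (hφ : ∀ x, 0 ≤ φ x) (x : Fin m → ℕ) :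
    ∑' y, step C x y * ENNReal.ofReal (φ y) = ENNReal.ofReal (avg C φ x) := by
  unfold step avg
  split_ifs with h
  · have hc : (0 : ℝ) < (nonFull C x).card := Nat.cast_pos.2 h.card_pos
    rw [PMF.map, tsum_bind_mul]
    simp only [Function.comp_apply, tsum_pure_mul, PMF.uniformOfFinset_apply]
    rw [tsum_fintype]
    simp only [ite_mul, zero_mul]
    rw [Finset.sum_ite_mem, Finset.univ_inter, ← Finset.mul_sum,
      ← ENNReal.ofReal_sum_of_nonneg fun j _ => hφ _, div_eq_inv_mul,
      ENNReal.ofReal_mul (by positivity), ENNReal.ofReal_inv_of_pos hc, ENNReal.ofReal_natCast]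
  · exact tsum_pure_mul _ _

theorem tsum_loadLaw_mul (m C n : ℕ) : ∀ {φ : (Fin m → ℕ) → ℝ}, (∀ x, 0 ≤ φ x) →
    ∑' x, loadLaw m C n x * ENNReal.ofReal (φ x) =
      ENNReal.ofReal ((avg C)^[n] φ fun _ => 0) := by
  induction n with
  | zero => intro φ _; exact tsum_pure_mul _ _
  | succ n ih =>
    intro φ hφ
    rw [loadLaw, tsum_bind_mul]
    simp only [tsum_step_mul hφ]
    exact ih (avg_nonneg hφ)

/-- The fraction of non-full bins. -/
def frac {m : ℕ} (C : ℕ) (x : Fin m → ℕ) : ℝ := ((nonFull C x).card : ℝ) / m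

theorem frac_nonneg {m C : ℕ} (x : Fin m → ℕ) : 0 ≤ frac C x := by unfold frac; positivity

theorem frac_le_one {m C : ℕ} (x : Fin m → ℕ) : frac C x ≤ 1 := by
  unfold frac
  refine div_le_one_of_le₀ ?_ (Nat.cast_nonneg _)
  exact_mod_cast (Finset.card_le_univ _).trans (Fintype.card_fin m).le

theorem frac_eq_sum {m C : ℕ} (x : Fin m → ℕ) :
    frac C x = (∑ j, if x j < C then (1 : ℝ) else 0) / m := by
  unfold frac nonFull
  rw [Finset.card_filter]; push_cast; rfl

theorem iterate_avg_nonneg {m C : ℕ} {φ : (Fin m → ℕ) → ℝ} (hφ : ∀ x, 0 ≤ φ x) (k : ℕ) :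
    ∀ x, 0 ≤ (avg C)^[k] φ x := by
  induction k with
  | zero => exact hφ
  | succ k ih => intro x; rw [Function.iterate_succ_apply']; exact avg_nonneg ih x

theorem expectedNonFullFraction_eq (m C n : ℕ) :
    expectedNonFullFraction m C n = (avg C)^[n] (frac C) fun _ : Fin m => 0 := by
  change ∫ x, frac C x ∂(loadLaw m C n).toMeasure = _
  rw [integral_toMeasure_eq_toReal_tsum _ fun x => frac_nonneg (C := C) x,
    tsum_loadLaw_mul m C n frac_nonneg, ENNReal.toReal_ofReal (iterate_avg_nonneg frac_nonneg n _)]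

theorem place_self {m : ℕ} (x : Fin m → ℕ) (j : Fin m) : place x j j = x j + 1 := by
  simp [place]

theorem place_of_ne {m : ℕ} (x : Fin m → ℕ) {i j : Fin m} (h : i ≠ j) : place x j i = x i := by
  simp [place, h]

theorem sum_place {m : ℕ} (x : Fin m → ℕ) (j : Fin m) : ∑ i, place x j i = ∑ i, x i + 1 := by
  unfold place
  rw [Finset.sum_update_of_mem (Finset.mem_univ j), ← Finset.add_sum_erase _ x (Finset.mem_univ j),
    Finset.sdiff_singleton_eq_erase]
  ring

theorem frac_place_le {m C : ℕ} (x : Fin m → ℕ) (j : Fin m) :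
    frac C (place x j) ≤ frac C x := by
  unfold frac
  gcongr
  intro i hi
  simp only [nonFull, Finset.mem_filter, Finset.mem_univ, true_and] at hi ⊢
  by_cases h : i = j
  · subst h; rw [place_self] at hi; omega
  · rwa [place_of_ne x h] at hi

theorem avg_frac_le {m C : ℕ} (x : Fin m → ℕ) : avg C (frac C) x ≤ frac C x := by
  unfold avg
  split_ifs with h
  · have hc : (0 : ℝ) < (nonFull C x).card := Nat.cast_pos.2 h.card_pos
    rw [div_le_iff₀ hc, mul_comm, ← nsmul_eq_mul]
    exact Finset.sum_le_card_nsmul _ _ _ fun j _ => frac_place_le x j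
  · exact le_rfl

theorem iterate_avg_frac_le {m C : ℕ} (k : ℕ) :
    ∀ x : Fin m → ℕ, (avg C)^[k] (frac C) x ≤ frac C x := by
  induction k with
  | zero => exact fun x => le_rfl
  | succ k ih =>
    intro x
    rw [Function.iterate_succ_apply']
    exact (avg_mono ih x).trans (avg_frac_le x)

/-! ### Value functions and the generator. -/

/-- The configuration obtained from `x` by throwing a ball at bin `j`; the ball is lost if the bin
is full. -/
def throwAt {m : ℕ} (C : ℕ) (x : Fin m → ℕ) (j : Fin m) : Fin m → ℕ :=
  if x j < C then place x j else x

/-- The value function of the chain run until `n` balls are in the bins. -/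
def value {m : ℕ} (C n : ℕ) (x : Fin m → ℕ) : ℝ := (avg C)^[n - ∑ i, x i] (frac C) x

theorem value_nonneg {m C n : ℕ} (x : Fin m → ℕ) : 0 ≤ value C n x :=
  iterate_avg_nonneg frac_nonneg _ _

theorem value_le_frac {m C n : ℕ} (x : Fin m → ℕ) : value C n x ≤ frac C x :=
  iterate_avg_frac_le _ _

theorem value_zero (m C n : ℕ) :
    value C n (fun _ : Fin m => 0) = expectedNonFullFraction m C n := by
  rw [expectedNonFullFraction_eq]; simp [value]

theorem value_of_le {m C n : ℕ} {x : Fin m → ℕ} (h : n ≤ ∑ i, x i) : value C n x = frac C x := by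
  unfold value; rw [Nat.sub_eq_zero_of_le h]; rfl

/-- Full bins contribute nothing, and over the non-full ones the value is the average of its
successors. Only agreement with `value` up to `n` balls is required, so the lemma serves both
continuations. -/
theorem sum_throwAt_eq_zero {m C n : ℕ} {x : Fin m → ℕ} (hx : ∑ i, x i < n)
    {F : (Fin m → ℕ) → ℝ} (hF : ∀ y : Fin m → ℕ, ∑ i, y i ≤ n → F y = value C n y) :
    ∑ j, (F (throwAt C x j) - F x) = 0 := by
  have e : ∀ j, F (throwAt C x j) - F x =
      if j ∈ nonFull C x then F (place x j) - F x else 0 := fun j => by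
    simp only [throwAt, nonFull, Finset.mem_filter, Finset.mem_univ, true_and]
    split_ifs <;> simp
  simp only [e]
  rw [Finset.sum_ite_mem, Finset.univ_inter]
  by_cases h : (nonFull C x).Nonempty
  · have hc : ((nonFull C x).card : ℝ) ≠ 0 := (Nat.cast_pos.2 h.card_pos).ne'
    obtain ⟨k, hk⟩ : ∃ k, n - ∑ i, x i = k + 1 := ⟨n - ∑ i, x i - 1, by omega⟩
    have hv : F x = (∑ j ∈ nonFull C x, F (place x j)) / (nonFull C x).card := by
      rw [hF x hx.le, value, hk, Function.iterate_succ_apply', avg, if_pos h]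
      congr 1
      refine Finset.sum_congr rfl fun j _ => ?_
      rw [hF _ (by rw [sum_place]; omega), value, sum_place,
        show n - (∑ i, x i + 1) = k by omega]
    rw [Finset.sum_sub_distrib, Finset.sum_const, nsmul_eq_mul, hv]
    field_simp
    ring
  · rw [Finset.not_nonempty_iff_eq_empty.1 h, Finset.sum_empty]

theorem sum_throwAt_value_le {m C n : ℕ} (x : Fin m → ℕ) :
    ∑ j, (value C n (throwAt C x j) - value C n x) ≤ 0 := by
  rcases lt_or_ge (∑ i, x i) n with h | h
  · exact (sum_throwAt_eq_zero h fun y _ => rfl).le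
  · refine Finset.sum_nonpos fun j _ => ?_
    unfold throwAt
    split_ifs
    · rw [value_of_le h, value_of_le (by rw [sum_place]; omega)]
      linarith [frac_place_le (C := C) x j]
    · simp

/-- The value function, replaced by `1` once more than `n` balls are in the bins. -/
def upperValue {m : ℕ} (C n : ℕ) (x : Fin m → ℕ) : ℝ :=
  if ∑ i, x i ≤ n then value C n x else 1

/-- Below `n` balls the sum vanishes; from `n` on, every successful throw leads to the maximal value
`1`. -/
theorem le_sum_throwAt_upperValue {m C n : ℕ} (x : Fin m → ℕ) :
    0 ≤ ∑ j, (upperValue C n (throwAt C x j) - upperValue C n x) := by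
  rcases lt_or_ge (∑ i, x i) n with h | h
  · exact (sum_throwAt_eq_zero h fun y hy => if_pos hy).ge
  · refine Finset.sum_nonneg fun j _ => ?_
    unfold throwAt
    split_ifs
    · have : upperValue C n (place x j) = 1 := if_neg (by rw [sum_place]; omega)
      rw [this]
      unfold upperValue
      split_ifs
      · linarith [value_le_frac (C := C) (n := n) x, frac_le_one (C := C) x]
      · simp
    · simp

theorem expectedNonFullFraction_le_one (m C n : ℕ) : expectedNonFullFraction m C n ≤ 1 := by
  rw [← value_zero]
  exact (value_le_frac _).trans (frac_le_one _)

/-! ### Independent truncated Poisson loads. -/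

/-- The law of `min (d + 1) N` on `{0, …, d + 1}`, for a Poisson variable `N` of mean `l`. -/
def cpoi (d : ℕ) (l : ℝ) (k : ℕ) : ℝ := if k ≤ d then poi l k else 1 - tail d l

/-- The expectation of a function of `min (d + 1) N`. -/
def mean (d : ℕ) (l : ℝ) (φ : ℕ → ℝ) : ℝ := ∑ k ∈ Finset.range (d + 2), cpoi d l k * φ k

/-- The expectation of a function of `m` independent copies of `min (d + 1) N`. -/
def prodMean (m d : ℕ) (l : ℝ) (F : (Fin m → ℕ) → ℝ) : ℝ :=
  ∑ x ∈ Fintype.piFinset fun _ : Fin m => Finset.range (d + 2), (∏ j, cpoi d l (x j)) * F x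

theorem mean_eq (d : ℕ) (l : ℝ) (φ : ℕ → ℝ) :
    mean d l φ = ∑ k ∈ Finset.range (d + 1), poi l k * φ k + (1 - tail d l) * φ (d + 1) := by
  unfold mean
  rw [Finset.sum_range_succ]
  congr 1
  · refine Finset.sum_congr rfl fun k hk => ?_
    rw [cpoi, if_pos (Nat.lt_succ_iff.1 (Finset.mem_range.1 hk))]
  · rw [cpoi, if_neg (by omega)]

theorem mean_one (d : ℕ) (l : ℝ) : mean d l (fun _ => 1) = 1 := by
  rw [mean_eq]
  simp only [mul_one]
  change tail d l + (1 - tail d l) = 1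
  ring

theorem mean_lt (d : ℕ) (l : ℝ) :
    mean d l (fun k => if k < d + 1 then 1 else 0) = tail d l := by
  rw [mean_eq]
  simp only [lt_irrefl, if_false, mul_zero, add_zero]
  refine Finset.sum_congr rfl fun k hk => ?_
  rw [if_pos (Finset.mem_range.1 hk), mul_one]

theorem mean_sub (d : ℕ) (l : ℝ) : mean d l (fun k => (d : ℝ) + 1 - k) = gap d l := by
  rw [mean_eq]
  have : ∀ e : ℕ, ∑ k ∈ Finset.range (e + 1), poi l k * ((e : ℝ) + 1 - k) = gap e l := fun e => by
    induction e with
    | zero => simp [gap, psum_zero]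
    | succ e ih =>
      unfold gap at *
      rw [psum_succ, ← ih, Finset.sum_range_succ, psum, Finset.sum_range_succ _ (e + 1),
        ← add_assoc, ← Finset.sum_add_distrib]
      push_cast
      congr 1
      · exact Finset.sum_congr rfl fun k _ => by ring
      · ring
  rw [this]
  push_cast
  ring

theorem tail_le_one {l : ℝ} (hl : 0 ≤ l) (d : ℕ) : tail d l ≤ 1 := by
  have h := Real.sum_le_exp_of_nonneg hl (d + 1)
  have : tail d l = Real.exp (-l) * ∑ i ∈ Finset.range (d + 1), l ^ i / (i.factorial : ℝ) := by
    rw [Finset.mul_sum, tail, psum]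
    exact Finset.sum_congr rfl fun k _ => mul_div_assoc _ _ _
  rw [this]
  calc _ ≤ Real.exp (-l) * Real.exp l := by gcongr
    _ = 1 := by rw [← Real.exp_add]; simp

theorem cpoi_nonneg {l : ℝ} (hl : 0 ≤ l) (d k : ℕ) : 0 ≤ cpoi d l k := by
  unfold cpoi
  split_ifs
  · exact poi_nonneg hl k
  · linarith [tail_le_one hl d]

/-- The number of free places lies between `0` and `d + 1`, so its square is at most `d + 1` times
itself. This is the variance bound behind Chebyshev. -/
theorem mean_sub_sq_le {l : ℝ} (hl : 0 ≤ l) (d : ℕ) :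
    mean d l (fun k => ((d : ℝ) + 1 - k) ^ 2) ≤ ((d : ℝ) + 1) * gap d l := by
  rw [← mean_sub, mean, mean, Finset.mul_sum]
  refine Finset.sum_le_sum fun k hk => ?_
  have h1 := cpoi_nonneg hl d k
  have h2 : (k : ℝ) ≤ d + 1 := by
    exact_mod_cast Nat.lt_succ_iff.1 (Finset.mem_range.1 hk)
  have h3 : (0 : ℝ) ≤ k := k.cast_nonneg
  calc cpoi d l k * ((d : ℝ) + 1 - k) ^ 2 = cpoi d l k * (((d : ℝ) + 1 - k) * ((d : ℝ) + 1 - k)) := by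
        ring
    _ ≤ cpoi d l k * (((d : ℝ) + 1) * ((d : ℝ) + 1 - k)) := by
        gcongr
        all_goals linarith
    _ = _ := by ring

theorem prodMean_prod (m d : ℕ) (l : ℝ) (g : Fin m → ℕ → ℝ) :
    prodMean m d l (fun x => ∏ i, g i (x i)) = ∏ i, mean d l (g i) := by
  unfold prodMean mean
  rw [Finset.prod_univ_sum]
  exact Finset.sum_congr rfl fun x _ => Finset.prod_mul_distrib.symm

theorem prodMean_coord (m d : ℕ) (l : ℝ) (j : Fin m) (φ : ℕ → ℝ) :
    prodMean m d l (fun x => φ (x j)) = mean d l φ := by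
  have h := prodMean_prod m d l fun i k => if i = j then φ k else 1
  simp only [Finset.prod_ite_eq', Finset.mem_univ, if_true] at h
  rw [h, Finset.prod_eq_single j]
  · simp
  · intro i _ hi; simp only [hi, if_false]; exact mean_one d l
  · simp

theorem prodMean_coord_mul_coord (m d : ℕ) (l : ℝ) {i j : Fin m} (hij : i ≠ j) (φ : ℕ → ℝ) :
    prodMean m d l (fun x => φ (x i) * φ (x j)) = mean d l φ * mean d l φ := by
  have h := prodMean_prod m d l fun a k => (if a = i then φ k else 1) * (if a = j then φ k else 1)
  simp only [Finset.prod_mul_distrib, Finset.prod_ite_eq', Finset.mem_univ, if_true] at h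
  rw [h, ← Finset.mul_prod_erase _ _ (Finset.mem_univ i),
    Finset.prod_eq_single_of_mem j (Finset.mem_erase.2 ⟨hij.symm, Finset.mem_univ j⟩)]
  · simp [hij, hij.symm]
  · intro a ha haj
    simp only [haj, (Finset.mem_erase.1 ha).1, if_false, mul_one]
    exact mean_one d l

theorem prodMean_mono {m d : ℕ} {l : ℝ} (hl : 0 ≤ l) {F G : (Fin m → ℕ) → ℝ}
    (h : ∀ x, (∀ j, x j ≤ d + 1) → F x ≤ G x) : prodMean m d l F ≤ prodMean m d l G := by
  refine Finset.sum_le_sum fun x hx => mul_le_mul_of_nonneg_left (h x fun j => ?_)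
    (Finset.prod_nonneg fun j _ => cpoi_nonneg hl d _)
  exact Nat.lt_succ_iff.1 (Finset.mem_range.1 (Fintype.mem_piFinset.1 hx j))

theorem prodMean_add (m d : ℕ) (l : ℝ) (F G : (Fin m → ℕ) → ℝ) :
    prodMean m d l (fun x => F x + G x) = prodMean m d l F + prodMean m d l G := by
  simp only [prodMean, mul_add, Finset.sum_add_distrib]

theorem prodMean_mul_const (m d : ℕ) (l c : ℝ) (F : (Fin m → ℕ) → ℝ) :
    prodMean m d l (fun x => F x * c) = prodMean m d l F * c := by
  simp only [prodMean, ← mul_assoc, Finset.sum_mul]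

theorem prodMean_sum {ι : Type*} (s : Finset ι) (m d : ℕ) (l : ℝ) (F : ι → (Fin m → ℕ) → ℝ) :
    prodMean m d l (fun x => ∑ i ∈ s, F i x) = ∑ i ∈ s, prodMean m d l (F i) := by
  simp only [prodMean, Finset.mul_sum]
  exact Finset.sum_comm

theorem prodMean_frac {m : ℕ} (hm : 0 < m) (d : ℕ) (l : ℝ) :
    prodMean m d l (frac (d + 1)) = tail d l := by
  have : (frac (d + 1) : (Fin m → ℕ) → ℝ) =
      fun x => (∑ j, if x j < d + 1 then (1 : ℝ) else 0) * (m : ℝ)⁻¹ :=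
    funext fun x => by rw [frac_eq_sum, div_eq_mul_inv]
  rw [this, prodMean_mul_const, prodMean_sum]
  have e : ∀ j : Fin m, prodMean m d l (fun x => if x j < d + 1 then (1 : ℝ) else 0) = tail d l :=
    fun j => by rw [prodMean_coord m d l j fun k => if k < d + 1 then (1 : ℝ) else 0, mean_lt]
  simp only [e]
  have : (m : ℝ) ≠ 0 := by positivity
  rw [Finset.sum_const, Finset.card_univ, Fintype.card_fin, nsmul_eq_mul]
  field_simp

theorem prodMean_sq_sum (m d : ℕ) (l : ℝ) {φ : ℕ → ℝ} (hφ : mean d l φ = 0) :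
    prodMean m d l (fun x => (∑ j, φ (x j)) ^ 2) = m * mean d l (fun k => φ k ^ 2) := by
  simp only [sq, Finset.sum_mul_sum, prodMean_sum]
  have e : ∀ i j : Fin m, prodMean m d l (fun x => φ (x i) * φ (x j)) =
      if i = j then mean d l (fun k => φ k * φ k) else 0 := fun i j => by
    split_ifs with h
    · subst h; exact prodMean_coord m d l i fun k => φ k * φ k
    · rw [prodMean_coord_mul_coord m d l h, hφ, zero_mul]
  simp [e]

/-- Chebyshev's inequality for the number of free places. -/
theorem prodMean_indicator_le {m d : ℕ} {l s : ℝ} (hl : 0 < l) (hs : 0 < s)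
    (S : (Fin m → ℕ) → Prop) [DecidablePred S]
    (hS : ∀ x, S x → s ≤ |(m : ℝ) * (d + 1) - (∑ j, x j : ℕ) - m * gap d l|) :
    prodMean m d l (fun x => if S x then 1 else 0) ≤ m * ((d + 1) * gap d l) / s ^ 2 := by
  set φ : ℕ → ℝ := fun k => ((d : ℝ) + 1 - k) - gap d l with hφ
  have lin : ∀ (a b : ℕ → ℝ) (c : ℝ), mean d l (fun k => a k - c * b k) =
      mean d l a - c * mean d l b := fun a b c => by
    simp only [mean, Finset.mul_sum, ← Finset.sum_sub_distrib]
    exact Finset.sum_congr rfl fun k _ => by ring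
  have h0 : mean d l φ = 0 := by
    have := lin (fun k => (d : ℝ) + 1 - k) (fun _ => 1) (gap d l)
    rw [mean_sub, mean_one, mul_one, sub_self] at this
    simpa [hφ] using this
  have h1 : mean d l (fun k => φ k ^ 2) ≤ (d + 1) * gap d l := by
    have e1 : mean d l (fun k => φ k ^ 2) =
        mean d l (fun k => ((d : ℝ) + 1 - k) ^ 2) - gap d l ^ 2 := by
      have e2 : (fun k => φ k ^ 2) = fun k =>
          (((d : ℝ) + 1 - k) ^ 2 - gap d l * φ k) - gap d l * ((d : ℝ) + 1 - k) :=
        funext fun k => by simp only [hφ]; ring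
      rw [e2, lin (fun k => ((d : ℝ) + 1 - k) ^ 2 - gap d l * φ k),
        lin (fun k => ((d : ℝ) + 1 - k) ^ 2), h0, mean_sub]
      ring
    rw [e1]
    nlinarith [mean_sub_sq_le hl.le d, sq_nonneg (gap d l)]
  have h2 : prodMean m d l (fun x => if S x then 1 else 0) * s ^ 2 ≤
      prodMean m d l (fun x => (∑ j, φ (x j)) ^ 2) := by
    rw [← prodMean_mul_const]
    refine prodMean_mono hl.le fun x _ => ?_
    split_ifs with h
    · rw [one_mul]
      refine sq_le_sq' ?_ ?_ |>.trans (sq_abs _).le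
      · have := abs_nonneg (∑ j, φ (x j)); linarith
      · refine (hS x h).trans (le_of_eq (congrArg _ ?_))
        simp only [hφ, Finset.sum_sub_distrib, Finset.sum_const, Finset.card_univ,
          Fintype.card_fin, nsmul_eq_mul]
        push_cast
        ring
    · rw [zero_mul]; positivity
  rw [le_div_iff₀ (by positivity)]
  refine h2.trans ?_
  rw [prodMean_sq_sum m d l h0]
  gcongr

/-! ### Forward equation and comparison with the chain. -/

theorem hasDerivAt_cpoi {d k : ℕ} (hk : k < d + 2) (l : ℝ) :
    HasDerivAt (fun l => cpoi d l k)
      ((if 1 ≤ k then cpoi d l (k - 1) else 0) - if k < d + 1 then cpoi d l k else 0) l := by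
  rcases Nat.lt_or_ge k (d + 1) with h | h
  · have e : (fun l => cpoi d l k) = fun l => poi l k :=
      funext fun l => if_pos (Nat.lt_succ_iff.1 h)
    have e' : cpoi d l k = poi l k := if_pos (Nat.lt_succ_iff.1 h)
    rw [e, if_pos h, e']
    cases k with
    | zero => simpa using hasDerivAt_poi_zero l
    | succ k =>
      rw [if_pos (by omega), Nat.add_sub_cancel, cpoi, if_pos (by omega)]
      exact hasDerivAt_poi_succ k l
  · obtain rfl : k = d + 1 := by omega
    have e : (fun l => cpoi d l (d + 1)) = fun l => 1 - tail d l :=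
      funext fun l => if_neg (by omega)
    rw [e, if_pos (by omega), if_neg (by omega), Nat.add_sub_cancel, cpoi, if_pos le_rfl]
    exact ((hasDerivAt_tail d l).const_sub 1).congr_deriv (by ring)

/-- Reindexes the inflow at bin `j` by the configuration before the arrival. -/
theorem sum_prod_erase_shift (m d : ℕ) (w : ℕ → ℝ) (F : (Fin m → ℕ) → ℝ) (j : Fin m) :
    ∑ x ∈ Fintype.piFinset fun _ : Fin m => Finset.range (d + 2),
      ((∏ i ∈ Finset.univ.erase j, w (x i)) * if 1 ≤ x j then w (x j - 1) else 0) * F x =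
    ∑ x ∈ Fintype.piFinset fun _ : Fin m => Finset.range (d + 2),
      if x j < d + 1 then (∏ i, w (x i)) * F (place x j) else 0 := by
  simp only [mul_ite, ite_mul, mul_zero, zero_mul]
  rw [← Finset.sum_filter, ← Finset.sum_filter]
  symm
  refine Finset.sum_nbij' (fun x => place x j) (fun x => Function.update x j (x j - 1))
    ?_ ?_ ?_ ?_ ?_
  · intro x hx
    simp only [Finset.mem_filter, Fintype.mem_piFinset, Finset.mem_range] at hx ⊢
    refine ⟨fun i => ?_, by rw [place_self]; omega⟩
    by_cases h : i = j
    · subst h; rw [place_self]; omega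
    · rw [place_of_ne x h]; exact hx.1 i
  · intro x hx
    simp only [Finset.mem_filter, Fintype.mem_piFinset, Finset.mem_range] at hx ⊢
    refine ⟨fun i => ?_, ?_⟩
    · by_cases h : i = j
      · subst h; have := hx.1 i; simp; omega
      · simpa [h] using hx.1 i
    · have := hx.1 j; simp; omega
  · intro x _
    simp [place]
  · intro x hx
    simp only [Finset.mem_filter] at hx
    simp [place, Nat.sub_add_cancel hx.2]
  · intro x _
    rw [place_self, Nat.add_sub_cancel, ← Finset.prod_erase_mul _ _ (Finset.mem_univ j)]
    congr 2
    refine Finset.prod_congr rfl fun i hi => ?_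
    rw [place_of_ne x (Finset.ne_of_mem_erase hi)]

/-- The forward equation for independent Poisson arrivals at bins of capacity `d + 1`. -/
theorem hasDerivAt_prodMean (m d : ℕ) (F : (Fin m → ℕ) → ℝ) (l : ℝ) :
    HasDerivAt (fun l => prodMean m d l F)
      (prodMean m d l fun x => ∑ j, (F (throwAt (d + 1) x j) - F x)) l := by
  have h : ∀ x ∈ Fintype.piFinset fun _ : Fin m => Finset.range (d + 2),
      HasDerivAt (fun l => (∏ j, cpoi d l (x j)) * F x)
        ((∑ j, (∏ i ∈ Finset.univ.erase j, cpoi d l (x i)) •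
          ((if 1 ≤ x j then cpoi d l (x j - 1) else 0) -
            if x j < d + 1 then cpoi d l (x j) else 0)) * F x) l := fun x hx => by
    refine HasDerivAt.mul_const (HasDerivAt.fun_finsetProd fun j _ => ?_) _
    exact hasDerivAt_cpoi (Finset.mem_range.1 (Fintype.mem_piFinset.1 hx j)) l
  refine (HasDerivAt.fun_sum h).congr_deriv ?_
  unfold prodMean
  simp only [Finset.sum_mul, Finset.mul_sum, smul_eq_mul]
  rw [Finset.sum_comm, Finset.sum_comm (s := Fintype.piFinset _) (t := Finset.univ)]
  refine Finset.sum_congr rfl fun j _ => ?_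
  simp only [mul_sub, sub_mul, Finset.sum_sub_distrib]
  rw [sum_prod_erase_shift, ← Finset.sum_sub_distrib, ← Finset.sum_sub_distrib]
  refine Finset.sum_congr rfl fun x _ => ?_
  unfold throwAt
  split_ifs
  · rw [Finset.prod_erase_mul _ _ (Finset.mem_univ j)]
  · ring

theorem prodMean_zero (m d : ℕ) (F : (Fin m → ℕ) → ℝ) :
    prodMean m d 0 F = F fun _ => 0 := by
  have hp : ∀ k, poi 0 k = if k = 0 then 1 else 0 := fun k => by
    unfold poi; split_ifs with h <;> simp [h]
  have hc : ∀ k, cpoi d 0 k = if k = 0 then 1 else 0 := fun k => by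
    unfold cpoi tail psum
    simp only [hp]
    split_ifs <;> simp_all
  unfold prodMean
  rw [Finset.sum_eq_single fun _ => 0]
  · simp [hc]
  · intro x _ hx
    obtain ⟨j, hj⟩ := Function.ne_iff.1 hx
    rw [Finset.prod_eq_zero (Finset.mem_univ j) (by rw [hc, if_neg hj]), zero_mul]
  · intro h; simp at h

/-- The derivative in `l` is the mean of the generator applied to `value`, hence nonpositive; at `l
= 0` all bins are empty. -/
theorem prodMean_value_le {m d n : ℕ} {l : ℝ} (hl : 0 ≤ l) :
    prodMean m d l (value (d + 1) n) ≤ expectedNonFullFraction m (d + 1) n := by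
  rw [← value_zero, ← prodMean_zero m d (value (d + 1) n)]
  have := antitoneOn_of_deriv_nonpos (convex_Ici (0 : ℝ))
    (fun v _ => (hasDerivAt_prodMean m d (value (d + 1) n) v).continuousAt.continuousWithinAt)
    (fun v _ => (hasDerivAt_prodMean m d (value (d + 1) n) v).differentiableAt.differentiableWithinAt)
    fun v hv => by
      rw [(hasDerivAt_prodMean m d (value (d + 1) n) v).deriv]
      refine (prodMean_mono (interior_subset hv) fun x _ => sum_throwAt_value_le x).trans ?_
      simp [prodMean]
  exact this (Set.mem_Ici.2 le_rfl) hl hl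

theorem le_prodMean_upperValue {m d n : ℕ} {l : ℝ} (hl : 0 ≤ l) :
    expectedNonFullFraction m (d + 1) n ≤ prodMean m d l (upperValue (d + 1) n) := by
  have e : upperValue (d + 1) n (fun _ : Fin m => 0) = expectedNonFullFraction m (d + 1) n := by
    rw [← value_zero]; simp [upperValue]
  rw [← e, ← prodMean_zero m d (upperValue (d + 1) n)]
  have := monotoneOn_of_deriv_nonneg (convex_Ici (0 : ℝ))
    (fun v _ => (hasDerivAt_prodMean m d (upperValue (d + 1) n) v).continuousAt.continuousWithinAt)
    (fun v _ =>
      (hasDerivAt_prodMean m d (upperValue (d + 1) n) v).differentiableAt.differentiableWithinAt)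
    fun v hv => by
      rw [(hasDerivAt_prodMean m d (upperValue (d + 1) n) v).deriv]
      refine le_trans ?_ (prodMean_mono (interior_subset hv) fun x _ => le_sum_throwAt_upperValue x)
      simp [prodMean]
  exact this (Set.mem_Ici.2 le_rfl) hl hl

/-- Lower bound by the Poisson tail at a mean where the expected gap is at most half the average
number `η` of free places per bin. -/
theorem tail_sub_le_expectedNonFullFraction {m d n : ℕ} {l η : ℝ} (hm : 0 < m) (hl : 0 < l)
    (hη : 0 < η) (hn : (n : ℝ) + m * η = m * (d + 1)) (hg : gap d l ≤ η / 2) :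
    tail d l - 2 * (d + 1) / (m * η) ≤ expectedNonFullFraction m (d + 1) n := by
  have hmr : (0 : ℝ) < m := by exact_mod_cast hm
  -- Fewer than `n` balls means more than `m * η` free places, against an expectation of at most `m
  -- * η / 2`.
  have h1 := prodMean_indicator_le (m := m) (d := d) (s := m * η / 2) hl (by positivity)
    (fun x => ∑ j, x j < n) fun x hx => by
      have : ((∑ j, x j : ℕ) : ℝ) ≤ n := by exact_mod_cast hx.le
      refine le_trans ?_ (le_abs_self _)
      have : m * gap d l ≤ m * (η / 2) := by gcongr
      linarith
  have h2 : m * ((d + 1) * gap d l) / (m * η / 2) ^ 2 ≤ 2 * (d + 1) / (m * η) := by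
    calc _ ≤ m * ((d + 1) * (η / 2)) / (m * η / 2) ^ 2 := by gcongr
      _ = _ := by field_simp
  have h3 : tail d l ≤ prodMean m d l (value (d + 1) n) +
      prodMean m d l (fun x => if ∑ j, x j < n then 1 else 0) := by
    rw [← prodMean_frac hm, ← prodMean_add]
    refine prodMean_mono hl.le fun x _ => ?_
    split_ifs with h
    · linarith [frac_le_one (C := d + 1) x, value_nonneg (C := d + 1) (n := n) x]
    · rw [value_of_le (not_lt.1 h), add_zero]
  linarith [prodMean_value_le (m := m) (d := d) (n := n) hl.le]

/-- Upper bound by the Poisson tail at a mean where the expected gap is twice the average number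
`η` of free places per bin. -/
theorem expectedNonFullFraction_le_tail_add {m d n : ℕ} {l η : ℝ} (hm : 0 < m) (hl : 0 < l)
    (hη : 0 < η) (hn : (n : ℝ) + m * η = m * (d + 1)) (hg : gap d l = 2 * η) :
    expectedNonFullFraction m (d + 1) n ≤ tail d l + 2 * (d + 1) / (m * η) := by
  have hmr : (0 : ℝ) < m := by exact_mod_cast hm
  -- More than `n` balls means fewer than `m * η` free places, against an expectation of `2 * m *
  -- η`.
  have h1 := prodMean_indicator_le (m := m) (d := d) (s := m * η) hl (by positivity)
    (fun x => n < ∑ j, x j) fun x hx => by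
      have : (n : ℝ) ≤ ((∑ j, x j : ℕ) : ℝ) := by exact_mod_cast hx.le
      refine le_trans ?_ (neg_le_abs _)
      rw [hg]
      linarith
  have h2 : m * ((d + 1) * gap d l) / (m * η) ^ 2 = 2 * (d + 1) / (m * η) := by
    rw [hg]; field_simp
  have h3 : prodMean m d l (upperValue (d + 1) n) ≤ tail d l +
      prodMean m d l (fun x => if n < ∑ j, x j then 1 else 0) := by
    rw [← prodMean_frac hm, ← prodMean_add]
    refine prodMean_mono hl.le fun x _ => ?_
    unfold upperValue
    split_ifs with h h' h'
    · omega
    · linarith [value_le_frac (C := d + 1) (n := n) x]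
    · linarith [frac_nonneg (C := d + 1) x]
    · omega
  linarith [le_prodMean_upperValue (m := m) (d := d) (n := n) hl.le]

/-! ### Locating the mean in the three regimes. -/

theorem mul_gap_le_tail {l R : ℝ} (hl : 0 < l) (d : ℕ) (h : R * l ≤ l - ((d : ℝ) + 1)) :
    R * gap d l ≤ tail d l := by
  have h1 := hazard_ge hl d
  have h2 := mul_le_mul_of_nonneg_right h (gap_pos hl d).le
  refine le_of_mul_le_mul_left ?_ hl
  nlinarith

theorem exp_one_lt : Real.exp 1 < 2.72 := Real.exp_one_lt_d9.trans (by norm_num)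

/-- Elementary facts on `log (1 / (ε √C))` in the middle regime. -/
theorem log_inv_facts {ε c : ℝ} (hε : 0 < ε) (hc : 1 ≤ c) (h1 : Real.log (1 / ε) < c)
    (h2 : c < 1 / (2 * ε ^ 2)) :
    1 / 4 ≤ Real.log (1 / (ε * √c)) ∧ Real.log (1 / (ε * √c)) ≤ c ∧
      Real.exp (-Real.log (1 / (ε * √c))) = ε * √c := by
  have hs : 1 ≤ √c := Real.one_le_sqrt.2 hc
  have hss : √c ^ 2 = c := Real.sq_sqrt (by linarith)
  have hp : 0 < ε * √c := by positivity
  refine ⟨?_, ?_, ?_⟩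
  · rw [lt_div_iff₀ (by positivity)] at h2
    have h3 : (ε * √c) ^ 2 < 1 / 2 := by rw [mul_pow, hss]; linarith
    have h4 := Real.log_lt_log (by positivity) h3
    rw [Real.log_pow, one_div, Real.log_inv] at h4
    rw [one_div (ε * √c), Real.log_inv]
    push_cast at h4
    linarith [Real.log_two_gt_d9]
  · refine (Real.log_le_log (by positivity) ?_).trans h1.le
    exact one_div_le_one_div_of_le hε (by nlinarith)
  · rw [one_div, Real.log_inv, neg_neg, Real.exp_log hp]

theorem half_mul_le_f {ε : ℝ} (hε : 0 < ε) (hε1 : ε < 1) {C : ℕ} (hC : 1 ≤ C) :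
    min (ε * √C) 1 ≤ 2 * f ε C := by
  have hc : (1 : ℝ) ≤ C := by exact_mod_cast hC
  have hs : 1 ≤ √(C : ℝ) := Real.one_le_sqrt.2 hc
  have hss : √(C : ℝ) ^ 2 = C := Real.sq_sqrt (by linarith)
  unfold f
  split_ifs with h1 h2
  · refine (min_le_left _ _).trans ?_
    have : √(C : ℝ) ≤ C := by nlinarith
    have := mul_le_mul_of_nonneg_left this hε.le
    have : 0 < ε * C := by positivity
    linarith
  · refine (min_le_left _ _).trans ?_
    have h3 := (log_inv_facts hε hc (not_le.1 h1) h2).1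
    have h4 : 1 / 2 ≤ √(Real.log (1 / (ε * √(C : ℝ)))) := by
      refine Real.le_sqrt_of_sq_le ?_
      linarith
    have : 0 < ε * √(C : ℝ) := by positivity
    nlinarith
  · exact (min_le_right _ _).trans (by norm_num)

/-- Lets the Chebyshev error be absorbed into `f`. -/
theorem le_two_mul_f {ε : ℝ} (hε : 0 < ε) (hε1 : ε < 1) {C : ℕ} (hC : 1 ≤ C) :
    ε ≤ 2 * f ε C := by
  have hs : 1 ≤ √(C : ℝ) := Real.one_le_sqrt.2 (by exact_mod_cast hC)
  refine le_trans (le_min ?_ hε1.le) (half_mul_le_f hε hε1 hC)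
  nlinarith

/-- The hazard rate is at most `1`, so from `c = d + 1` to `3c/2` the gap loses at most a factor
`exp (-c/2)`. As `ε ≤ exp (-c)`, the level `η / 2` is reached only beyond `3c/2`, where the rate is
at least `1/3`. -/
theorem exists_gap_le_half_of_le_log {d : ℕ} {ε η : ℝ} (hε : 0 < ε)
    (h1 : ε * (d + 1) / 2 ≤ η) (h2 : η < ε * (d + 1))
    (hC : (d : ℝ) + 1 ≤ Real.log (1 / ε)) :
    ∃ l, 0 < l ∧ gap d l ≤ η / 2 ∧ ε * (d + 1) / 80 ≤ tail d l := by
  have hg := le_gap_mean d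
  set c : ℝ := (d : ℝ) + 1 with hc
  have hc1 : 1 ≤ c := by rw [hc]; linarith [(Nat.cast_nonneg d : (0 : ℝ) ≤ d)]
  have hc0 : 0 < c := by linarith
  have hss : √c ^ 2 = c := Real.sq_sqrt hc0.le
  have hs : 1 ≤ √c := Real.one_le_sqrt.2 hc1
  have hη : 0 < η := lt_of_lt_of_le (by positivity) h1
  have he : ε ≤ Real.exp (-c) := by
    rw [one_div, Real.log_inv] at hC
    rw [← Real.exp_log hε]
    exact Real.exp_le_exp.2 (by linarith)
  have hsq : √c ≤ Real.exp ((c - 1) / 2) := by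
    refine abs_le_of_sq_le_sq' ?_ (Real.exp_pos _).le |>.2
    rw [hss, ← Real.exp_nat_mul]
    have := Real.add_one_le_exp (c - 1)
    calc c ≤ Real.exp (c - 1) := by linarith
      _ = _ := by congr 1; push_cast; ring
  have hlow := le_gap_of_hazard_le (d := d) (R := 1) (x := c) (y := 3 * c / 2) (by linarith)
    fun v hv => by rw [one_mul]; exact tail_le_gap (by linarith [hv.1]) d
  have hlt : η / 2 < gap d (3 * c / 2) := by
    refine lt_of_lt_of_le ?_ hlow
    rw [show -(1 * (3 * c / 2 - c)) = -(c / 2) by ring]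
    have e1 : Real.exp (-c) = Real.exp (-(c / 2)) * Real.exp (-(c / 2)) := by
      rw [← Real.exp_add]; congr 1; ring
    have e2 : Real.exp ((c - 1) / 2) * Real.exp (-(c / 2)) * Real.exp (1 / 2) = 1 := by
      rw [← Real.exp_add, ← Real.exp_add, ← Real.exp_zero]; congr 1; ring
    have e3 : Real.exp 1 = Real.exp (1 / 2) * Real.exp (1 / 2) := by
      rw [← Real.exp_add]; congr 1; norm_num
    have e4 : Real.exp (1 / 2) ≤ 2 := by
      refine abs_le_of_sq_le_sq' ?_ (by norm_num) |>.2
      rw [sq, ← e3]; linarith [exp_one_lt]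
    set E := Real.exp (-(c / 2))
    have hE : 0 < E := Real.exp_pos _
    set G := Real.exp (1 / 2)
    have hG : 0 < G := Real.exp_pos _
    have s1 : √c * E * G ≤ 1 := by
      rw [← e2]; gcongr
    have s2 : Real.exp 1 * (√c * E) ≤ 2 := by
      rw [e3]; nlinarith
    have s3 : Real.exp 1 * (η / 2) < Real.exp 1 * (gap d c * E) := by
      calc Real.exp 1 * (η / 2) < Real.exp 1 * (ε * c / 2) := by gcongr
        _ ≤ Real.exp 1 * (E * E * c / 2) := by rw [← e1]; gcongr
        _ = (Real.exp 1 * (√c * E)) * (√c * E) / 2 := by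
          linear_combination (-(Real.exp 1 * E ^ 2 / 2)) * hss
        _ ≤ 2 * (√c * E) / 2 := by gcongr
        _ = √c * E := by ring
        _ ≤ Real.exp 1 * gap d c * E := by gcongr
        _ = _ := by ring
    exact lt_of_mul_lt_mul_left s3 (Real.exp_pos _).le
  have hmono : gap d (3 * c / 2) ≤ gap d c :=
    gap_antitoneOn d (Set.mem_Ioi.2 hc0) (Set.mem_Ioi.2 (by positivity)) (by linarith)
  obtain ⟨l, hl, hgl⟩ := exists_gap_eq (d := d) (t := η / 2) (by positivity) (hlt.le.trans hmono)
  rw [← hc] at hl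
  have hl0 : 0 < l := by linarith
  have hle : 3 * c / 2 ≤ l := le_of_gap_le hl0 (by positivity) (by rw [hgl]; exact hlt)
  refine ⟨l, hl0, hgl.le, ?_⟩
  have := mul_gap_le_tail (R := 1 / 3) hl0 d (by rw [← hc]; linarith)
  rw [hgl] at this
  nlinarith

theorem exists_gap_le_half_of_lt {d : ℕ} {ε η : ℝ} (hε : 0 < ε)
    (h1 : ε * (d + 1) / 2 ≤ η) (h2 : η < ε * (d + 1))
    (hC : Real.log (1 / ε) < (d : ℝ) + 1) (hC' : (d : ℝ) + 1 < 1 / (2 * ε ^ 2)) :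
    ∃ l, 0 < l ∧ gap d l ≤ η / 2 ∧
      ε * √((d : ℝ) + 1) * √(Real.log (1 / (ε * √((d : ℝ) + 1)))) / 80 ≤ tail d l := by
  have hg := le_gap_mean d
  set c : ℝ := (d : ℝ) + 1 with hc
  have hc1 : 1 ≤ c := by rw [hc]; linarith [(Nat.cast_nonneg d : (0 : ℝ) ≤ d)]
  have hc0 : 0 < c := by linarith
  obtain ⟨hL1, hL2, hL3⟩ := log_inv_facts hε hc1 hC hC'
  set L := Real.log (1 / (ε * √c))
  have hss : √c ^ 2 = c := Real.sq_sqrt hc0.le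
  have hqq : √L ^ 2 = L := Real.sq_sqrt (by linarith)
  have hqs : √L ≤ √c := Real.sqrt_le_sqrt hL2
  have hs : 0 < √c := Real.sqrt_pos.2 hc0
  have hq : 0 < √L := Real.sqrt_pos.2 (by linarith)
  have hη : 0 < η := lt_of_lt_of_le (by positivity) h1
  generalize √c = s at *
  generalize √L = q at *
  -- The summands of `R` serve the two conditions of `hazard_le`: `q / (2 * s)` the linear one, `2 /
  -- s` the quadratic one.
  have hlow := le_gap_of_hazard_le (d := d) (R := q / (2 * s) + 2 / s) (x := c)
    (y := c + s * q / 4) (by have := mul_pos hs hq; linarith) fun v hv => by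
      have hcR : c * (q / (2 * s) + 2 / s) = s * q / 2 + 2 * s := by
        rw [← hss]; field_simp
      have hR : 0 < q / (2 * s) + 2 / s := by positivity
      refine hazard_le d hv.1 hR ?_ ?_
      · rw [← hc]
        have := mul_le_mul_of_nonneg_right hv.1 hR.le
        linarith [hv.2]
      · have h3 : (2 / s) ^ 2 ≤ (q / (2 * s) + 2 / s) ^ 2 := by
          gcongr
          have : 0 < q / (2 * s) := by positivity
          linarith
        have h4 : c * (2 / s) ^ 2 = 4 := by rw [← hss]; field_simp; norm_num
        calc 4 = c * (2 / s) ^ 2 := h4.symm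
          _ ≤ v * (q / (2 * s) + 2 / s) ^ 2 := by
            have := hv.1
            gcongr
            linarith
  have hlt : η / 8 < gap d (c + s * q / 4) := by
    refine lt_of_lt_of_le ?_ hlow
    have e1 : (q / (2 * s) + 2 / s) * (c + s * q / 4 - c) = q ^ 2 / 8 + q / 2 := by
      field_simp; ring
    have e2 : Real.exp (-L) * Real.exp (-1) ≤
        Real.exp (-((q / (2 * s) + 2 / s) * (c + s * q / 4 - c))) := by
      rw [e1, ← Real.exp_add]
      refine Real.exp_le_exp.2 ?_
      rw [← hqq]
      nlinarith [sq_nonneg (q - 1)]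
    have e3 : Real.exp 1 * Real.exp (-1) = 1 := by rw [← Real.exp_add]; simp
    have e4 : Real.exp 1 * Real.exp 1 < 8 := by
      nlinarith [exp_one_lt, Real.exp_pos 1]
    have hgp : 0 < gap d c := gap_pos hc0 d
    have k1 : gap d c * (Real.exp (-L) * Real.exp (-1)) ≤
        gap d c * Real.exp (-((q / (2 * s) + 2 / s) * (c + s * q / 4 - c))) := by gcongr
    refine lt_of_lt_of_le ?_ k1
    rw [hL3]
    have k2 : Real.exp 1 * Real.exp 1 * (η / 8) <
        Real.exp 1 * Real.exp 1 * (gap d c * (ε * s * Real.exp (-1))) := by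
      calc Real.exp 1 * Real.exp 1 * (η / 8) ≤ 8 * (η / 8) := by gcongr
        _ = η := by ring
        _ < ε * c := h2
        _ = s * (ε * s) := by rw [← hss]; ring
        _ ≤ Real.exp 1 * gap d c * (ε * s) := by gcongr
        _ = Real.exp 1 * gap d c * (ε * s) * (Real.exp 1 * Real.exp (-1)) := by rw [e3, mul_one]
        _ = _ := by ring
    exact lt_of_mul_lt_mul_left k2 (by positivity)
  have hsq : 0 < s * q := by positivity
  have hmono : gap d (c + s * q / 4) ≤ gap d c :=
    gap_antitoneOn d (Set.mem_Ioi.2 hc0) (Set.mem_Ioi.2 (by positivity)) (by linarith)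
  -- The level is `η / 8` because Stirling and the exponent bound `q² / 8 + q / 2 ≤ L + 1` each cost
  -- a factor `e`, and `e² < 8`.
  obtain ⟨l, hl, hgl⟩ := exists_gap_eq (d := d) (t := η / 8) (by positivity) (hlt.le.trans hmono)
  rw [← hc] at hl
  have hl0 : 0 < l := by linarith
  have hle : c + s * q / 4 ≤ l := le_of_gap_le hl0 (by positivity) (by rw [hgl]; exact hlt)
  refine ⟨l, hl0, by rw [hgl]; linarith, ?_⟩
  have hR : q / (5 * s) * l ≤ l - c := by
    have e1 : q / (5 * s) ≤ 1 := by rw [div_le_one (by positivity)]; linarith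
    have e2 : (c + s * q / 4) * (1 - q / (5 * s)) = c + s * q / 20 - q ^ 2 / 20 := by
      rw [← hss]; field_simp; ring
    have e3 := mul_le_mul_of_nonneg_right hle (sub_nonneg.2 e1)
    nlinarith
  have := mul_gap_le_tail hl0 d hR
  rw [hgl] at this
  refine le_trans ?_ this
  calc ε * s * q / 80 = q / (5 * s) * (ε * c / 2 / 8) := by rw [← hss]; field_simp; norm_num
    _ ≤ _ := by gcongr

theorem exists_gap_le_half_of_ge {d : ℕ} {ε η : ℝ} (hε : 0 < ε)
    (h1 : ε * (d + 1) / 2 ≤ η) (hC : 1 / (2 * ε ^ 2) ≤ (d : ℝ) + 1) :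
    ∃ l, 0 < l ∧ gap d l ≤ η / 2 ∧ 1 / 80 ≤ tail d l := by
  have hg := le_gap_mean d
  have hg' := gap_mean_le d
  set c : ℝ := (d : ℝ) + 1 with hc
  have hc1 : 1 ≤ c := by rw [hc]; linarith [(Nat.cast_nonneg d : (0 : ℝ) ≤ d)]
  have hc0 : 0 < c := by linarith
  have hss : √c ^ 2 = c := Real.sq_sqrt hc0.le
  have hs1 : 1 ≤ √c := Real.one_le_sqrt.2 hc1
  have hsqrt : √(16 * c) = 4 * √c := by
    rw [Real.sqrt_mul (by norm_num), show (16 : ℝ) = 4 ^ 2 by norm_num, Real.sqrt_sq (by norm_num)]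
  set s := √c
  have hs : 0 < s := by linarith
  have hεs : 1 / 2 ≤ ε * s := by
    rw [div_le_iff₀ (by positivity), ← hss] at hC
    refine abs_le_of_sq_le_sq' ?_ (by positivity) |>.2
    nlinarith
  -- On `[c, 16c]` the rate is at least `1 / √v ≥ 1 / (4s)`, enough to push the gap below `s / 8 ≤ η
  -- / 2` before `16c`.
  have hup := gap_le_of_le_hazard (d := d) (R := 1 / (4 * s)) (x := c) (y := 16 * c)
    (by linarith) fun v hv => by
      have h3 := hazard_ge_sqrt d hv.1
      have h4 : √v ≤ 4 * s := hsqrt ▸ Real.sqrt_le_sqrt hv.2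
      have h5 := tail_pos (lt_of_lt_of_le hc0 hv.1) d
      rw [div_mul_eq_mul_div, one_mul, div_le_iff₀ (by positivity)]
      nlinarith
  have hlt : gap d (16 * c) < s / 8 := by
    refine hup.trans_lt ?_
    have e1 : 1 / (4 * s) * (16 * c - c) = 15 / 4 * s := by rw [← hss]; field_simp; ring
    have e2 : 8 < Real.exp (15 / 4 * s) := by
      refine lt_of_lt_of_le ?_ (Real.quadratic_le_exp_of_nonneg (by positivity))
      nlinarith
    rw [e1, Real.exp_neg, ← div_eq_mul_inv, div_lt_div_iff₀ (Real.exp_pos _) (by norm_num)]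
    nlinarith
  have hle : s / 8 ≤ gap d c := by
    have := gap_pos hc0 d
    nlinarith [exp_one_lt]
  obtain ⟨l, hl, hgl⟩ := exists_gap_eq (d := d) (t := s / 8) (by positivity) hle
  rw [← hc] at hl
  have hl0 : 0 < l := by linarith
  have hl16 : l ≤ 16 * c := le_of_gap_le (by positivity) hl0 (by rw [hgl]; exact hlt)
  refine ⟨l, hl0, ?_, ?_⟩
  · rw [hgl]
    rw [← hss] at h1
    nlinarith
  · have h3 := hazard_ge_sqrt d hl
    rw [hgl] at h3
    have h4 : √l ≤ 4 * s := hsqrt ▸ Real.sqrt_le_sqrt hl16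
    have h5 := tail_pos hl0 d
    have h6 : s / 8 ≤ 4 * s * tail d l := h3.trans (by gcongr)
    have h7 : s * (1 / 8) ≤ s * (4 * tail d l) := by linarith
    have := le_of_mul_le_mul_left h7 hs
    linarith

theorem exists_gap_le_half {d : ℕ} {ε η : ℝ} (hε : 0 < ε)
    (h1 : ε * (d + 1) / 2 ≤ η) (h2 : η < ε * (d + 1)) :
    ∃ l, 0 < l ∧ gap d l ≤ η / 2 ∧ f ε (d + 1) / 80 ≤ tail d l := by
  unfold f
  push_cast
  split_ifs with h3 h4
  · exact exists_gap_le_half_of_le_log hε h1 h2 h3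
  · exact exists_gap_le_half_of_lt hε h1 h2 (not_le.1 h3) h4
  · exact exists_gap_le_half_of_ge hε h1 (not_lt.1 h4)

theorem exists_gap_eq_two_mul {d : ℕ} {ε η : ℝ} (hε : 0 < ε) (hε1 : ε < 1)
    (h1 : ε * (d + 1) / 2 < η) (h2 : η ≤ ε * (d + 1)) :
    1 ≤ 24 * f ε (d + 1) ∨ ∃ l, 0 < l ∧ gap d l = 2 * η ∧ tail d l ≤ 24 * f ε (d + 1) := by
  have hg := le_gap_mean d
  have hg' := gap_mean_le d
  have hmin := half_mul_le_f hε hε1 (C := d + 1) (by omega)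
  push_cast at hmin
  set c : ℝ := (d : ℝ) + 1 with hc
  have hc1 : 1 ≤ c := by rw [hc]; linarith [(Nat.cast_nonneg d : (0 : ℝ) ≤ d)]
  have hc0 : 0 < c := by linarith
  have hss : √c ^ 2 = c := Real.sq_sqrt hc0.le
  have hs : 0 < √c := Real.sqrt_pos.2 hc0
  have hη : 0 < η := lt_trans (by positivity) h1
  -- Above `1/6`, `f` is bounded below and the bound `E[X] ≤ 1` suffices; otherwise `2 * η` is at
  -- most the gap at `c`, so the level is attained.
  rcases lt_or_ge (1 / 6) (ε * √c) with hb | hb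
  · left
    have : 1 / 6 ≤ min (ε * √c) 1 := le_min hb.le (by norm_num)
    linarith
  right
  have hle : 2 * η ≤ gap d c := by
    have := gap_pos hc0 d
    have e1 : 2 * η ≤ 2 * (1 / 6 * √c) := by
      have : ε * c = ε * √c * √c := by rw [mul_assoc, ← sq, hss]
      nlinarith
    nlinarith [exp_one_lt]
  obtain ⟨l, hl, hgl⟩ := exists_gap_eq (d := d) (t := 2 * η) (by positivity) hle
  rw [← hc] at hl
  have hl0 : 0 < l := by linarith
  refine ⟨l, hl0, hgl, ?_⟩
  unfold f
  push_cast
  rw [← hc]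
  split_ifs with h3 h4
  · have := tail_le_gap hl0 d
    have : 0 < ε * c := by positivity
    linarith
  · obtain ⟨hL1, hL2, hL3⟩ := log_inv_facts hε hc1 (not_le.1 h3) h4
    set L := Real.log (1 / (ε * √c))
    have hqq : √L ^ 2 = L := Real.sq_sqrt (by linarith)
    have hqs : √L ≤ √c := Real.sqrt_le_sqrt hL2
    have hq : 0 < √L := Real.sqrt_pos.2 (by linarith)
    generalize √c = s at *
    generalize √L = q at *
    have hsq : 0 < s * q := by positivity
    have hsqc : s * q ≤ c := by rw [← hss]; nlinarith
    -- Across this interval the exponent is `9cL / (c + 6sq) ≥ L`, since `sq ≤ c`; the gap falls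
    -- below `s * exp (-L) = ε * c < 2 * η`, which forces `l ≤ c + 6sq`.
    have hup := gap_le_of_le_hazard (d := d) (R := 3 * (s * q) / (c + 6 * (s * q)))
      (x := c + 3 * (s * q)) (y := c + 6 * (s * q)) (by linarith) fun v hv => by
        have hv0 : 0 < v := by linarith [hv.1]
        refine mul_gap_le_tail hv0 d ?_
        rw [← hc]
        have : 3 * (s * q) / (c + 6 * (s * q)) * v ≤ 3 * (s * q) := by
          rw [div_mul_eq_mul_div, div_le_iff₀ (by positivity)]
          have := hv.2
          gcongr
        linarith [hv.1]
    have hlt : gap d (c + 6 * (s * q)) < gap d l := by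
      refine hup.trans_lt ?_
      have e1 : L ≤ 3 * (s * q) / (c + 6 * (s * q)) * (c + 6 * (s * q) - (c + 3 * (s * q))) := by
        rw [div_mul_eq_mul_div, le_div_iff₀ (by positivity)]
        have : (s * q) * (s * q) = c * L := by rw [← hss, ← hqq]; ring
        have : L * (s * q) ≤ L * c := by gcongr
        nlinarith
      have e2 : gap d (c + 3 * (s * q)) ≤ s :=
        (gap_antitoneOn d (Set.mem_Ioi.2 hc0) (Set.mem_Ioi.2 (by positivity))
          (by linarith)).trans hg'
      calc _ ≤ s * Real.exp (-L) := by gcongr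
        _ = ε * c := by rw [hL3, ← hss]; ring
        _ < gap d l := by rw [hgl]; linarith
    have hll : l ≤ c + 6 * (s * q) := le_of_gap_le (by positivity) hl0 hlt
    have hz := hazard_le (R := 12 * q / s) d hl (by positivity)
      (by
        rw [← hc]
        have : c * (12 * q / s) ≤ l * (12 * q / s) := by gcongr
        have e : c * (12 * q / s) = 12 * (s * q) := by rw [← hss]; field_simp
        linarith)
      (by
        have : c * (12 * q / s) ^ 2 ≤ l * (12 * q / s) ^ 2 := by gcongr
        have e : c * (12 * q / s) ^ 2 = 144 * L := by rw [← hss, ← hqq]; field_simp; norm_num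
        linarith)
    refine hz.trans ?_
    rw [hgl]
    calc 12 * q / s * (2 * η) ≤ 12 * q / s * (2 * (ε * c)) := by gcongr
      _ = 24 * (ε * s * q) := by rw [← hss]; field_simp; norm_num
  · linarith [tail_le_one hl0.le d]

end CapacitatedBins

end

/-! ### Assembly of the bounds. -/

theorem mainTheorem3 :
    ∃ c₁ c₂ : ℝ, 0 < c₁ ∧ 0 < c₂ ∧
      ∀ g : ℕ → ℝ, Tendsto g atTop (𝓝 0) →
        ∃ m₀ : ℕ, ∀ (m n C : ℕ) (ε : ℝ), m₀ ≤ m → 1 ≤ C → 0 < ε → ε < 1 →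
          (C : ℝ) = (1 + ε) * n / m →
          1 / ε ≤ (m : ℝ) ^ (g m) →
            c₁ * CapacitatedBins.f ε C ≤ CapacitatedBins.expectedNonFullFraction m C n ∧
            CapacitatedBins.expectedNonFullFraction m C n ≤ c₂ * CapacitatedBins.f ε C := by
  open CapacitatedBins in
  refine ⟨1 / 160, 25, by norm_num, by norm_num, fun g hg => ?_⟩
  obtain ⟨m₁, hm₁⟩ := eventually_atTop.1 (hg.eventually (gt_mem_nhds (by norm_num : (0 : ℝ) < 1 / 4)))
  -- With `g m ≤ 1/4` one has `√m * ε² ≥ 1`, and `√m ≥ 1280` then gives `m * ε² ≥ 1280`, which makes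
  -- the Chebyshev error at most `ε / 320 ≤ f / 160`.
  refine ⟨max m₁ (1280 ^ 2), fun m n C ε hm hC hε hε1 hCn hεm => ?_⟩
  have hg4 : g m ≤ 1 / 4 := (hm₁ m (le_of_max_le_left hm)).le
  have hmK : (1280 : ℝ) ^ 2 ≤ m := by exact_mod_cast le_of_max_le_right hm
  have hm0 : (0 : ℝ) < m := by linarith
  obtain ⟨d, rfl⟩ : ∃ d, C = d + 1 := ⟨C - 1, by omega⟩
  have hfε := le_two_mul_f hε hε1 hC
  have hmε : 1280 ≤ m * ε ^ 2 := by
    have h1 : 1 / ε ≤ (m : ℝ) ^ (1 / 4 : ℝ) :=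
      hεm.trans (Real.rpow_le_rpow_of_exponent_le (by linarith) hg4)
    rw [div_le_iff₀ hε] at h1
    have h2 : ((m : ℝ) ^ (1 / 4 : ℝ)) ^ 2 = √m := by
      rw [← Real.rpow_natCast, ← Real.rpow_mul hm0.le, Real.sqrt_eq_rpow]; norm_num
    have h3 : 1 ≤ √m * ε ^ 2 := by rw [← h2, ← mul_pow]; exact one_le_pow₀ h1
    have h4 : 1280 ≤ √(m : ℝ) := Real.le_sqrt_of_sq_le hmK
    calc (1280 : ℝ) ≤ √m * 1 := by linarith
      _ ≤ √m * (√m * ε ^ 2) := by gcongr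
      _ = m * ε ^ 2 := by rw [← mul_assoc, Real.mul_self_sqrt hm0.le]
  push_cast at hCn
  -- This is `C - n / m`, the final average number of free places per bin.
  set η : ℝ := ε * (d + 1) / (1 + ε) with hη
  have hd : (0 : ℝ) < (d : ℝ) + 1 := by positivity
  have hη1 : ε * (d + 1) / 2 < η := by
    rw [hη]; gcongr; linarith
  have hη2 : η < ε * (d + 1) := div_lt_self (by positivity) (by linarith)
  have hη0 : 0 < η := by positivity
  have hn : (n : ℝ) + m * η = m * (d + 1) := by
    rw [hη, hCn]; field_simp
  have herr : 2 * ((d : ℝ) + 1) / (m * η) ≤ f ε (d + 1) / 160 := by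
    have e1 : 2 * ((d : ℝ) + 1) / (m * η) ≤ 2 * ((d : ℝ) + 1) / (m * (ε * (d + 1) / 2)) := by
      gcongr
    have e2 : 2 * ((d : ℝ) + 1) / (m * (ε * (d + 1) / 2)) = 4 / (m * ε) := by field_simp; norm_num
    have e3 : 4 / (m * ε) ≤ ε / 320 := by
      rw [div_le_div_iff₀ (by positivity) (by norm_num)]; nlinarith
    linarith
  have hm0' : 0 < m := by exact_mod_cast hm0
  constructor
  · obtain ⟨l, hl, hgl, ht⟩ := exists_gap_le_half hε hη1.le hη2
    have := tail_sub_le_expectedNonFullFraction hm0' hl hη0 hn hgl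
    linarith
  · rcases exists_gap_eq_two_mul hε hε1 hη1 hη2.le with h | ⟨l, hl, hgl, ht⟩
    · have := expectedNonFullFraction_le_one m (d + 1) n
      linarith
    · have := expectedNonFullFraction_le_tail_add hm0' hl hη0 hn hgl
      linarith
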